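/- **Setting.** Consider a network of $m$ elastoplastic springs on $n$ nodes with one displacement-controlled loading, $(D,A,C,R,l(t))$: an $m\times n$ kinematic matrix $D$ with $\mathrm{rank}\,D=n-1$, $m\ge n$; stiffnesses $A=\mathrm{diag}(a_1,\dots,a_m)$ with $a_j>0$; elastic limits $c_j^-\le c_j^+$ $(1\le j\le m)$; a vector $R\in\mathbb R^m$ with $\mathrm{rank}(D^TR)=1$; and a function $l:[0,\infty)\to\mathbb R$. Put $d=m-n+2$. Choose an $n\times(n-2)$ matrix $\mathcal M$ with $\mathrm{rank}(D\mathcal M)=n-2$ and $R^TD\mathcal M=0$; an $m\times d$ matrix $\mathcal V_{basis}$ with linearly independent columns and $(D\mathcal M)^TA\mathcal V_{basis}=0$; and an $m\times(m-n+1)$ matrix $D^\perp$ of rank $m-n+1$ with $(D^\perp)^TD=0$. Let $$\mathcal R=\begin{pmatrix}R^T\\(D^\perp)^T\end{pmatrix},\quad \mathbf e=\begin{pmatrix}1\\0_{m-n+1}\end{pmatrix},\quad W=\mathcal R\,\mathcal V_{basis},\quad \bar L=W^{-1}\mathbf e,\quad \mathcal V=\mathcal V_{basis}\mathbb R^d,\quad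 c(t)=-\mathcal V_{basis}\bar L\,l(t).$$ Equip $\mathcal V$ with the scalar product $(x,y)_A=\langle x,Ay\rangle$, with norm $\|\cdot\|^A$ and balls $B^A_\varepsilon(0)$. For $X\subset\mathcal V$ and $y\in X$ let $N^A_X(y)=\{x\in\mathcal V:\langle x,A(\xi-y)\rangle\le0\ \forall \xi\in X\}$, and let $N_X^A(y)=\emptyset$ for $y\notin X$. Write $c_j^{\alpha}=c_j^{\pm}$ for $\alpha=\pm1$. In $\mathcal V$ let $L(\alpha,j)=\{y:\langle\alpha e_j,Ay\rangle\le\alpha c_j^\alpha\}$, $\overline{\overline L}(\alpha,j)=\{y:\langle e_j,Ay\rangle=c_j^\alpha\}$, $C=\bigcap_j L(-1,j)\cap L(1,j)$ and $C(t)=C+c(t)$. The associated sweeping process is $-\dot y\in N^A_{C(t)}(y)$, $y\in\mathcal V$; its solutions are locally absolutely continuous and satisfy the inclusion for a.a. $t\ge0$. The stress vector $s(t)$ is related to $y(t)$ by $y(t)=A^{-1}s(t)-\mathcal V_{basis}\bar L\,l(t)$. For $I\subset\{-1,1\}\times\{1,\dots,m\}$ let $K(I)=\mathrm{cone}\{\mathcal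 R\,\alpha e_j:(\alpha,j)\in I\}$. **Index sets.** Let $I_0\subset\{-1,1\}\times\{1,\dots,m\}$ with $|I_0|\le d$. If $|I_0|<d$, let $I_1$ satisfy $|I_0|+|I_1|=d$ and $\mathrm{rank}\big(\mathcal R\{\alpha e_j:(\alpha,j)\in I_0\cup I_1\}\big)=d$; let $I_1,\dots,I_M$, $M=2^{d-|I_0|}$, be all the families obtained from $I_1$ by replacing some of its elements $(\alpha,j)$ by $(-\alpha,j)$; let $y_{*,i}$ be the point of $\bigcap_{(\alpha,j)\in I_0\cup I_i}\overline{\overline L}(\alpha,j)$; and let $$F=\bigcap_{(\alpha,j)\in I_0}\overline{\overline L}(\alpha,j)\ \cap\ \bigcap_{i=1}^M\bigcap_{(\alpha,j)\in I_i}L(\alpha,j).$$ If $|I_0|=d$, let $y_{*,0}$ be the point of $F=\bigcap_{(\alpha,j)\in I_0}\overline{\overline L}(\alpha,j)$. Put $F(t)=F+c(t)$. **Proposition.** Assume that - $l'(t)=l_1$ is constant on $[0,\infty)$; - $\mathbf e\,l_1\in K(I_0)$, and $\mathbf e\,l_1$ is not in the relative boundary of $K(I_0)$; if $|I_0|=d$,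 moreover $I_0$ is irreducible, i.e. $\mathbf e\,l_1\notin K(I_0\setminus\{p\})$ for every $p\in I_0$; - (feasibility) $c_j^-<\langle e_j,Ay_{*,i}\rangle<c_j^+$ for all $i\in\{1,\dots,M\}$ (for $i=0$ if $|I_0|=d$) and for every spring $j$ that occurs, with either sign, in none of the families $I_0,I_1,\dots,I_M$ (not in $I_0$ if $|I_0|=d$); - (non-coincidence) if $|I_0|<d$, then $c_j^-<c_j^+$ for all $(\alpha,j)\in I_i$, $1\le i\le M$. Then the points $y_{*,i}$ exist and are unique, and there is an $\varepsilon>0$ such that on every interval $[0,\tau_d]$ $$-\dot c(t)+B^A_\varepsilon(0)\cap N^A_F(y)\subset N^A_C(y),\qquad y\in F,\ \text{a.a. } t\in[0,\tau_d].$$ In particular, for all sufficiently large $\tau_d>0$, every solution $y$ of the sweeping process with $y(0)\in C(0)$ satisfies $y(\tau_d)\in F(\tau_d)$. Accordingly, for all sufficiently large $\tau_d$, the stress vector satisfies $s(\tau_d)\in\mathrm{conv}\{Ay_{*,1},\dots,Ay_{*,M}\}$ (that is, $s(\tau_d)=Ay_{*,0}$ if $|I_0|=d$). -/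

import Mathlib

open scoped Matrix
open MeasureTheory

noncomputable section

namespace Elastoplastic

/-- A signed spring index `(α, j)` with `α ∈ {-1, 1}`. -/
abbrev SignedIndex (m : ℕ) : Type := ℤˣ × Fin m

/-- The sign `α` as a real number. -/
def sgn {m : ℕ} (p : SignedIndex m) : ℝ := ((p.1 : ℤ) : ℝ)

/-- A (connected) network `(D, A, C, R, l(t))` of `m` elastoplastic springs on `n` nodes with one
displacement-controlled loading: kinematic matrix `D`, stiffnesses `A = diag(a₁, …, aₘ)`, achievable
stresses `C = ∏ⱼ [cⱼ⁻, cⱼ⁺]`, location `R` and magnitude `l(t)` of the loading. -/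
structure SpringNetwork (m n : ℕ) where
  D : Matrix (Fin m) (Fin n) ℝ
  a : Fin m → ℝ
  cMinus : Fin m → ℝ
  cPlus : Fin m → ℝ
  R : Fin m → ℝ
  l : ℝ → ℝ
  a_pos : ∀ j, 0 < a j
  c_le : ∀ j, cMinus j ≤ cPlus j
  n_le_m : n ≤ m
  rank_D : D.rank + 1 = n
  rank_DR : (Dᵀ * Matrix.replicateCol (Fin 1) R).rank = 1

namespace SpringNetwork

variable {m n : ℕ} (N : SpringNetwork m n)

/-- The stiffness matrix. -/
def A : Matrix (Fin m) (Fin m) ℝ := Matrix.diagonal N.a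

/-- The scalar product `(x, y)_A = ⟨x, A y⟩`. -/
def ip (x y : Fin m → ℝ) : ℝ := x ⬝ᵥ (N.A *ᵥ y)

/-- The norm `‖x‖^A = √⟨x, A x⟩`. -/
def normA (x : Fin m → ℝ) : ℝ := Real.sqrt (N.ip x x)

/-- `⟨e_j, A y⟩`. -/
def coord (j : Fin m) (y : Fin m → ℝ) : ℝ := N.ip (Pi.single j 1) y

/-- The elastic limit `c_j^α`. -/
def limit (p : SignedIndex m) : ℝ := if p.1 = 1 then N.cPlus p.2 else N.cMinus p.2

end SpringNetwork

/-- The dimension `d = m - n + 2` (used for `n ≤ m`). -/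
abbrev dimV (m n : ℕ) : ℕ := (m - n + 1) + 1

/-- The matrices chosen in the construction of the sweeping process of a network. -/
structure MoreauMatrices {m n : ℕ} (N : SpringNetwork m n) where
  M : Matrix (Fin n) (Fin (n - 2)) ℝ
  Vbasis : Matrix (Fin m) (Fin (dimV m n)) ℝ
  Dperp : Matrix (Fin m) (Fin (m - n + 1)) ℝ
  rank_DM : (N.D * M).rank = n - 2
  R_DM : N.R ᵥ* (N.D * M) = 0
  Vbasis_indep : LinearIndependent ℝ Vbasis.col
  Vbasis_orth : (N.D * M)ᵀ * N.A * Vbasis = 0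
  Dperp_D : Dperpᵀ * N.D = 0
  rank_Dperp : Dperp.rank = m - n + 1

/-- The vector `(1, 0, …, 0)ᵀ = (1, 0_{m-n+1})ᵀ`. -/
def firstVec (m n : ℕ) : Fin (dimV m n) → ℝ := Matrix.vecCons 1 0

namespace MoreauMatrices

variable {m n : ℕ} {N : SpringNetwork m n} (S : MoreauMatrices N)

/-- The block matrix with first row `Rᵀ` and the rows of `(D^⊥)ᵀ` below it. -/
def RD : Matrix (Fin (dimV m n)) (Fin m) ℝ := Matrix.of (Matrix.vecCons N.R S.Dperpᵀ)

/-- `W = (Rᵀ; (D^⊥)ᵀ) V_basis`. -/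
def W : Matrix (Fin (dimV m n)) (Fin (dimV m n)) ℝ := S.RD * S.Vbasis

/-- `L̄ = W⁻¹ (1, 0, …, 0)ᵀ`. -/
def Lbar : Fin (dimV m n) → ℝ := S.W⁻¹ *ᵥ firstVec m n

/-- The space `V = V_basis ℝ^d`. -/
def V : Submodule ℝ (Fin m → ℝ) := LinearMap.range S.Vbasis.mulVecLin

/-- `c(t) = - V_basis L̄ l(t)`. -/
def c (t : ℝ) : Fin m → ℝ := -(N.l t • (S.Vbasis *ᵥ S.Lbar))

/-- `L(α,j) = {y ∈ V : ⟨α e_j, A y⟩ ≤ α c_j^α}`. -/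
def halfSpace (p : SignedIndex m) : Set (Fin m → ℝ) :=
  {y | y ∈ S.V ∧ sgn p * N.coord p.2 y ≤ sgn p * N.limit p}

/-- `{y ∈ V : ⟨e_j, A y⟩ = c_j^α}`. -/
def hyperplane (p : SignedIndex m) : Set (Fin m → ℝ) :=
  {y | y ∈ S.V ∧ N.coord p.2 y = N.limit p}

/-- `C = ⋂ⱼ L(-1,j) ∩ L(+1,j)`, as a subset of `V`. -/
def C : Set (Fin m → ℝ) :=
  {y | y ∈ S.V ∧ ∀ j, y ∈ S.halfSpace (-1, j) ∩ S.halfSpace (1, j)}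

/-- The translate `X(t) = X + c(t)`. -/
def moving (X : Set (Fin m → ℝ)) (t : ℝ) : Set (Fin m → ℝ) := (fun x => x + S.c t) '' X

/-- The normal cone `N_X^A(y)` in `V` with the scalar product `(·,·)_A`; it is empty for `y ∉ X`. -/
def normalCone (X : Set (Fin m → ℝ)) (y : Fin m → ℝ) : Set (Fin m → ℝ) :=
  {x | y ∈ X ∧ x ∈ S.V ∧ ∀ ξ ∈ X, N.ip x (ξ - y) ≤ 0}

/-- `y` is a solution on `[0,∞)` of the sweeping process `-y' ∈ N_{C(t)}^A(y)`, `y ∈ V`, with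
`y(0) ∈ C(0)`: it is locally absolutely continuous and satisfies the inclusion almost everywhere. -/
structure IsSolution (y : ℝ → Fin m → ℝ) : Prop where
  ac : ∀ T, 0 ≤ T → AbsolutelyContinuousOnInterval y 0 T
  mem : ∀ t, 0 ≤ t → y t ∈ S.V
  init : y 0 ∈ S.moving S.C 0
  incl : ∀ᵐ t ∂(volume.restrict (Set.Ici (0 : ℝ))),
    DifferentiableAt ℝ y t ∧ -deriv y t ∈ S.normalCone (S.moving S.C t) (y t)

/-- `s` is a stress vector of the network: `y(t) = A⁻¹ s(t) - V_basis L̄ l(t)` solves the associated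
sweeping process. -/
def IsStress (s : ℝ → Fin m → ℝ) : Prop :=
  S.IsSolution (fun t => N.A⁻¹ *ᵥ s t - N.l t • (S.Vbasis *ᵥ S.Lbar))

/-- The vectors `(Rᵀ; (D^⊥)ᵀ) α e_j`. -/
def signedCol (p : SignedIndex m) : Fin (dimV m n) → ℝ :=
  S.RD *ᵥ (sgn p • Pi.single p.2 1)

/-- The cone generated by the vectors `(Rᵀ; (D^⊥)ᵀ) α e_j`, `(α,j) ∈ I`. -/
def indexCone (I : Finset (SignedIndex m)) : Set (Fin (dimV m n) → ℝ) :=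
  (PointedCone.hull ℝ (S.signedCol '' (I : Set (SignedIndex m))) :
    PointedCone ℝ (Fin (dimV m n) → ℝ))

/-- The cone inclusion for the loading rate `l' = l₁`. -/
def ConeInclusion (l₁ : ℝ) (I : Finset (SignedIndex m)) : Prop :=
  l₁ • firstVec m n ∈ S.indexCone I

/-- The cone inclusion in the strict sense: moreover the vector is not in the relative boundary of
the cone. -/
def StrictConeInclusion (l₁ : ℝ) (I : Finset (SignedIndex m)) : Prop :=
  S.ConeInclusion l₁ I ∧ l₁ • firstVec m n ∉ intrinsicFrontier ℝ (S.indexCone I)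

/-- `I` is irreducible: it is not of the form `J ∪ {p}`, `p ∉ J`, where `J` still satisfies the cone
inclusion. -/
def Irreducible (l₁ : ℝ) (I : Finset (SignedIndex m)) : Prop :=
  ¬ ∃ (J : Finset (SignedIndex m)) (p : SignedIndex m),
    p ∉ J ∧ I = insert p J ∧ S.ConeInclusion l₁ J

/-- The matrix with the columns `(Rᵀ; (D^⊥)ᵀ) α e_j`, `(α,j) ∈ I`. -/
def signedColMatrix (I : Finset (SignedIndex m)) : Matrix (Fin (dimV m n)) I ℝ :=
  Matrix.of fun i p => S.signedCol p.1 i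

end MoreauMatrices

/-- All index families obtained from `I₁` by replacing some of its elements `(α,j)` by `(-α,j)`,
`I₁` included. For `I₁ = ∅` the only such family is `∅`. -/
def flips {m : ℕ} (I₁ : Finset (SignedIndex m)) : Finset (Finset (SignedIndex m)) :=
  I₁.powerset.image fun T => (I₁ \ T) ∪ T.image fun p => (-p.1, p.2)

namespace MoreauMatrices

variable {m n : ℕ} {N : SpringNetwork m n} (S : MoreauMatrices N)

/-- The facet `F` defined by `I₀` and the families `I ∈ flips I₁`. For `I₁ = ∅` it is the
intersection of the hyperplanes of `I₀`. -/
def F (I₀ I₁ : Finset (SignedIndex m)) : Set (Fin m → ℝ) :=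
  {y | y ∈ S.V ∧ (∀ p ∈ I₀, y ∈ S.hyperplane p) ∧
    ∀ I ∈ flips I₁, ∀ p ∈ I, y ∈ S.halfSpace p}

/-- The set of all points of `V` on the hyperplanes of index family `K`. -/
def hyperplanes (K : Finset (SignedIndex m)) : Set (Fin m → ℝ) :=
  {y | y ∈ S.V ∧ ∀ p ∈ K, y ∈ S.hyperplane p}

/-- The vertex `y_*` of a family `K = I₀ ∪ I`: the point of `S.hyperplanes K` (meaningful when that
set is a singleton). -/
def vertex (K : Finset (SignedIndex m)) : Fin m → ℝ :=
  Classical.epsilon fun y => y ∈ S.hyperplanes K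

/-- Feasibility: at every vertex, all the springs that occur neither in `I₀` nor in one of the
families `I` are strictly within their elastic limits. -/
def Feasible (I₀ I₁ : Finset (SignedIndex m)) : Prop :=
  ∀ I ∈ flips I₁, ∀ j : Fin m,
    (∀ p ∈ I₀, p.2 ≠ j) → (∀ I' ∈ flips I₁, ∀ p ∈ I', p.2 ≠ j) →
    N.cMinus j < N.coord j (S.vertex (I₀ ∪ I)) ∧ N.coord j (S.vertex (I₀ ∪ I)) < N.cPlus j

/-- The condition `-c'(t) + B_ε^A(0) ∩ N_F^A(y) ⊆ N_C^A(y)` for all `y ∈ F` and a.a. `t ∈ [0,τ]`. -/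
def FacetCondition (F : Set (Fin m → ℝ)) (ε τ : ℝ) : Prop :=
  ∀ᵐ t ∂(volume.restrict (Set.Icc (0 : ℝ) τ)), DifferentiableAt ℝ S.c t ∧
    ∀ y ∈ F, ∀ ξ ∈ S.normalCone F y, N.normA ξ ≤ ε → -deriv S.c t + ξ ∈ S.normalCone S.C y

end MoreauMatrices

/-- Non-coincidence: `c_j⁻ < c_j⁺` for the springs of the families `I ∈ flips I₁`. -/
def SpringNetwork.NonCoincident {m n : ℕ} (N : SpringNetwork m n)
    (I₁ : Finset (SignedIndex m)) : Prop :=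
  ∀ I ∈ flips I₁, ∀ p ∈ I, N.cMinus p.2 < N.cPlus p.2

end Elastoplastic

end

/-! Let u = -c' = `V_basis L̄ l₁`. The map `lift` inverts `RD` on V, sends `e l₁` to u and sends
each signed column to the A-orthogonal projection of `α e_j` onto V. Lying in the relative interior
of the cone therefore means u = ∑ w_p n_p over `I₀`, with all w_p > 0 and n_p the normals of the
constraints active on F.

For x in C and y in F, φ(x) = (u, y - x)_A is the weighted sum of the gaps between the stresses of x
in `I₀` and their limits. It does not depend on y, it is nonnegative, and it controls every single
gap. The stresses along `I₀ ∪ I₁` are linear coordinates on V in which F is a box. Moving the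
`I₀`-stresses to their limits while keeping the others gives z in F with ‖x - z‖² ≤ Q φ(x)²
(`exists_gap_bound`). Feasibility at the vertices extends to their convex hull F, so F ⊆ C.

This one estimate carries both conclusions. Cauchy–Schwarz turns it into the facet condition with ε
= 1/√Q (`exists_add_mem_normalCone`). For a solution, x = y - c satisfies u - x' ∈ N_C(x) and (u,
x') = ‖x'‖², so φ' = -‖x'‖². Testing the normal cone with z gives φ ≤ (x', z - x) ≤ ‖x'‖ √Q φ. Hence
φ decreases at rate at least 1/Q while positive, and reaches 0, that is F, in a time that is uniform
because C is bounded (`exists_time_mem_facet`). -/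

namespace Elastoplastic

open Finset

/-! ### The energy scalar product. -/

namespace SpringNetwork

variable {m n : ℕ} (N : SpringNetwork m n)

lemma ip_eq_sum (x y : Fin m → ℝ) : N.ip x y = ∑ j, N.a j * x j * y j := by
  simp only [ip, A, dotProduct, Matrix.mulVec_diagonal]
  exact sum_congr rfl fun j _ => by ring

lemma coord_eq (j : Fin m) (y : Fin m → ℝ) : N.coord j y = N.a j * y j := by
  simp [coord, ip, A, Matrix.mulVec_diagonal]

lemma ip_comm (x y : Fin m → ℝ) : N.ip x y = N.ip y x := by
  simp only [ip_eq_sum]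
  exact sum_congr rfl fun j _ => by ring

lemma ip_add_left (x y z : Fin m → ℝ) : N.ip (x + y) z = N.ip x z + N.ip y z := by
  simp [ip, add_dotProduct]

lemma ip_sub_left (x y z : Fin m → ℝ) : N.ip (x - y) z = N.ip x z - N.ip y z := by
  simp [ip, sub_dotProduct]

lemma ip_smul_left (r : ℝ) (x z : Fin m → ℝ) : N.ip (r • x) z = r * N.ip x z := by
  simp [ip]

lemma ip_sum_left {ι : Type*} (s : Finset ι) (f : ι → Fin m → ℝ) (z : Fin m → ℝ) :
    N.ip (∑ i ∈ s, f i) z = ∑ i ∈ s, N.ip (f i) z := by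
  simp [ip, sum_dotProduct]

/-- The linear functional `⟨x, A ·⟩`. -/
noncomputable def ipRight (x : Fin m → ℝ) : (Fin m → ℝ) →ₗ[ℝ] ℝ where
  toFun := N.ip x
  map_add' y z := by simp [ip, Matrix.mulVec_add, dotProduct_add]
  map_smul' r y := by simp [ip, Matrix.mulVec_smul]

@[simp] lemma ipRight_apply (x y : Fin m → ℝ) : N.ipRight x y = N.ip x y := rfl

lemma ip_add_right (x y z : Fin m → ℝ) : N.ip x (y + z) = N.ip x y + N.ip x z :=
  (N.ipRight x).map_add y z

lemma ip_sub_right (x y z : Fin m → ℝ) : N.ip x (y - z) = N.ip x y - N.ip x z :=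
  (N.ipRight x).map_sub y z

lemma ip_smul_right (r : ℝ) (x z : Fin m → ℝ) : N.ip x (r • z) = r * N.ip x z :=
  (N.ipRight x).map_smul r z

/-- The linear functional `⟨e_j, A ·⟩`. -/
noncomputable def coordL (j : Fin m) : (Fin m → ℝ) →ₗ[ℝ] ℝ := N.ipRight (Pi.single j 1)

@[simp] lemma coordL_apply (j : Fin m) (y : Fin m → ℝ) : N.coordL j y = N.coord j y := rfl

lemma coord_sub (j : Fin m) (y z : Fin m → ℝ) : N.coord j (y - z) = N.coord j y - N.coord j z :=
  (N.coordL j).map_sub y z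

lemma ip_self_nonneg (x : Fin m → ℝ) : 0 ≤ N.ip x x := by
  rw [ip_eq_sum]
  exact sum_nonneg fun j _ => by
    rw [mul_assoc]; exact mul_nonneg (N.a_pos j).le (mul_self_nonneg _)

lemma eq_zero_of_ip_self {x : Fin m → ℝ} (h : N.ip x x = 0) : x = 0 := by
  rw [ip_eq_sum, sum_eq_zero_iff_of_nonneg] at h
  · ext j
    have := h j (mem_univ j)
    have ha := (N.a_pos j).ne'
    simpa [ha] using this
  · intro j _
    rw [mul_assoc]; exact mul_nonneg (N.a_pos j).le (mul_self_nonneg _)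

/-- Cauchy–Schwarz inequality for the energy scalar product. -/
lemma ip_sq_le (x y : Fin m → ℝ) : N.ip x y ^ 2 ≤ N.ip x x * N.ip y y := by
  have h : ∀ t : ℝ, 0 ≤ N.ip y y * (t * t) + 2 * N.ip x y * t + N.ip x x := fun t => by
    have := N.ip_self_nonneg (x + t • y)
    simp only [ip_add_left, ip_add_right, ip_smul_left, ip_smul_right, N.ip_comm y x] at this
    linarith
  have := discrim_le_zero h
  rw [discrim] at this
  linarith

/-- Ensures that the natural subtraction `n - 2` is not truncated in the dimension counts: for one
node D would have rank 0, and so would `Dᵀ R`. -/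
lemma two_le_n (N : SpringNetwork m n) : 2 ≤ n := by
  have h1 := N.rank_D
  have h2 := N.rank_DR
  by_contra hn
  obtain rfl : n = 1 := by omega
  have hD : N.D.rank = 0 := by omega
  have h3 := Matrix.rank_mul_le_left N.Dᵀ (Matrix.replicateCol (Fin 1) N.R)
  rw [Matrix.rank_transpose] at h3
  omega

lemma D_transpose_R_ne_zero : N.Dᵀ *ᵥ N.R ≠ 0 := by
  intro h
  have h2 := N.rank_DR
  rw [← Matrix.replicateCol_mulVec, h] at h2
  have h3 : (Matrix.replicateCol (Fin 1) (0 : Fin n → ℝ)) = 0 := by ext; simp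
  rw [h3, Matrix.rank_zero] at h2
  omega

end SpringNetwork

lemma sgn_mul_self {m : ℕ} (p : SignedIndex m) : sgn p * sgn p = 1 := by
  obtain ⟨u, j⟩ := p
  rcases Int.units_eq_one_or u with rfl | rfl <;> simp [sgn]

/-! ### The space V, its projection and its stress coordinates. -/

namespace MoreauMatrices

variable {m n : ℕ} {N : SpringNetwork m n} (S : MoreauMatrices N)

/-- The rows are independent: applying `Dᵀ` to a relation between R and the columns of `D^⊥` leaves
only the multiple of `Dᵀ R ≠ 0`, and the columns of `D^⊥` are independent among themselves. -/
lemma rank_RD : S.RD.rank = dimV m n := by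
  rw [← Matrix.rank_transpose]
  have hinj : Function.Injective S.RDᵀ.mulVecLin := by
    rw [← LinearMap.ker_eq_bot, LinearMap.ker_eq_bot']
    intro w hw
    have hexp : ∀ i, (S.RDᵀ *ᵥ w) i = N.R i * w 0 + ∑ k, S.Dperp i k * w k.succ := fun i => by
      rw [Matrix.mulVec, dotProduct, Fin.sum_univ_succ]
      rfl
    have hw' : w 0 • N.R + S.Dperp *ᵥ (fun i => w i.succ) = 0 := by
      ext i
      have h := hexp i
      rw [← Matrix.mulVecLin_apply, hw, mul_comm] at h
      exact h.symm
    have hDw : N.Dᵀ *ᵥ (S.Dperp *ᵥ (fun i => w i.succ)) = 0 := by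
      rw [Matrix.mulVec_mulVec]
      have := congrArg Matrix.transpose S.Dperp_D
      simp only [Matrix.transpose_mul, Matrix.transpose_transpose, Matrix.transpose_zero] at this
      rw [this, Matrix.zero_mulVec]
    have h0 : w 0 = 0 := by
      have := congrArg (N.Dᵀ *ᵥ ·) hw'
      simp only [Matrix.mulVec_add, hDw, Matrix.mulVec_smul, Matrix.mulVec_zero, add_zero] at this
      exact (smul_eq_zero.1 this).resolve_right N.D_transpose_R_ne_zero
    have hs : (fun i : Fin (m - n + 1) => w i.succ) = 0 := by
      rw [h0, zero_smul, zero_add] at hw'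
      have hi : LinearIndependent ℝ S.Dperp.col := by
        rw [linearIndependent_iff_card_eq_finrank_span, Fintype.card_fin]
        have := S.rank_Dperp
        rw [Matrix.rank_eq_finrank_span_cols] at this
        exact this.symm
      exact Matrix.mulVec_injective_iff.2 hi (by rw [hw', Matrix.mulVec_zero])
    ext i
    refine Fin.cases h0 (fun i => ?_) i
    exact congrFun hs i
  rw [Matrix.rank, LinearMap.finrank_range_of_inj hinj]
  simp

lemma RD_mul_DM : S.RD * (N.D * S.M) = 0 := by
  ext i j
  have h1 := congrFun S.R_DM j
  have h2 : S.Dperpᵀ * (N.D * S.M) = 0 := by rw [← Matrix.mul_assoc, S.Dperp_D, Matrix.zero_mul]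
  refine Fin.cases ?_ (fun i => ?_) i
  · rw [Matrix.mul_apply]
    exact h1
  · have := congrFun (congrFun h2 i) j
    rw [Matrix.mul_apply] at this ⊢
    exact this

/-- One inclusion is `RD_mul_DM`; both sides have dimension m - d = n - 2. -/
lemma ker_RD : LinearMap.ker S.RD.mulVecLin = LinearMap.range (N.D * S.M).mulVecLin := by
  symm
  apply Submodule.eq_of_le_of_finrank_eq
  · rintro _ ⟨z, rfl⟩
    simp [S.RD_mul_DM]
  · have h1 := LinearMap.finrank_range_add_finrank_ker S.RD.mulVecLin
    have h2 := S.rank_RD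
    have h3 := S.rank_DM
    rw [Matrix.rank] at h2 h3
    rw [h2] at h1
    rw [h3]
    simp only [Module.finrank_fintype_fun_eq_card, Fintype.card_fin, dimV] at h1
    have := N.two_le_n
    have := N.n_le_m
    omega

lemma ip_eq_zero_of_RD {x y : Fin m → ℝ} (hx : S.RD *ᵥ x = 0) (hy : y ∈ S.V) : N.ip x y = 0 := by
  have : x ∈ LinearMap.ker S.RD.mulVecLin := hx
  rw [S.ker_RD] at this
  obtain ⟨z, rfl⟩ := this
  obtain ⟨w, rfl⟩ := hy
  simp only [SpringNetwork.ip, Matrix.mulVecLin_apply]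
  rw [← Matrix.vecMul_transpose, ← Matrix.dotProduct_mulVec, Matrix.mulVec_mulVec,
    Matrix.mulVec_mulVec, S.Vbasis_orth]
  simp

lemma Vbasis_mem (z : Fin (dimV m n) → ℝ) : S.Vbasis *ᵥ z ∈ S.V := ⟨z, rfl⟩

lemma Vbasis_injective : Function.Injective S.Vbasis.mulVec :=
  Matrix.mulVec_injective_iff.2 S.Vbasis_indep

/-- A kernel vector gives an element of V that also lies in `ker RD`, the A-orthogonal complement of
V, so it is orthogonal to itself. -/
lemma isUnit_W : IsUnit S.W := by
  rw [← Matrix.mulVec_injective_iff_isUnit]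
  have : LinearMap.ker S.W.mulVecLin = ⊥ := by
    rw [LinearMap.ker_eq_bot']
    intro z hz
    have h : S.RD *ᵥ (S.Vbasis *ᵥ z) = 0 := by rw [Matrix.mulVec_mulVec]; exact hz
    have h0 := N.eq_zero_of_ip_self (S.ip_eq_zero_of_RD h (S.Vbasis_mem z))
    exact S.Vbasis_injective (by rw [h0, Matrix.mulVec_zero])
  exact LinearMap.ker_eq_bot.1 this

/-- The linear map `z ↦ V_basis W⁻¹ z`, an isomorphism of `ℝ^d` onto `V`. -/
noncomputable def lift : (Fin (dimV m n) → ℝ) →ₗ[ℝ] (Fin m → ℝ) := (S.Vbasis * S.W⁻¹).mulVecLin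

lemma lift_apply (z : Fin (dimV m n) → ℝ) : S.lift z = S.Vbasis *ᵥ (S.W⁻¹ *ᵥ z) := by
  simp [lift]

lemma lift_mem (z : Fin (dimV m n) → ℝ) : S.lift z ∈ S.V := by
  rw [lift_apply]; exact S.Vbasis_mem _

lemma lift_firstVec : S.lift (firstVec m n) = S.Vbasis *ᵥ S.Lbar := S.lift_apply _

lemma RD_lift (z : Fin (dimV m n) → ℝ) : S.RD *ᵥ S.lift z = z := by
  rw [lift_apply, Matrix.mulVec_mulVec, Matrix.mulVec_mulVec]
  change (S.W * S.W⁻¹) *ᵥ z = z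
  rw [Matrix.mul_nonsing_inv _ ((Matrix.isUnit_iff_isUnit_det _).1 S.isUnit_W), Matrix.one_mulVec]

/-- The lift of `RD x` is the energy-orthogonal projection of `x` onto `V`. -/
lemma ip_lift_RD (x : Fin m → ℝ) {y : Fin m → ℝ} (hy : y ∈ S.V) :
    N.ip (S.lift (S.RD *ᵥ x)) y = N.ip x y := by
  have h : S.RD *ᵥ (S.lift (S.RD *ᵥ x) - x) = 0 := by
    rw [Matrix.mulVec_sub, RD_lift, sub_self]
  have := S.ip_eq_zero_of_RD h hy
  rw [N.ip_sub_left] at this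
  linarith

lemma lift_RD {y : Fin m → ℝ} (hy : y ∈ S.V) : S.lift (S.RD *ᵥ y) = y := by
  have hV : S.lift (S.RD *ᵥ y) - y ∈ S.V := S.V.sub_mem (S.lift_mem _) hy
  have := S.ip_lift_RD y hV
  rw [← sub_eq_zero]
  apply N.eq_zero_of_ip_self
  rw [N.ip_sub_left]
  linarith

/-- The energy-orthogonal projection of `α e_j` onto `V`. -/
noncomputable def normal (p : SignedIndex m) : Fin m → ℝ := S.lift (S.signedCol p)

lemma normal_mem (p : SignedIndex m) : S.normal p ∈ S.V := S.lift_mem _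

lemma ip_normal (p : SignedIndex m) {y : Fin m → ℝ} (hy : y ∈ S.V) :
    N.ip (S.normal p) y = sgn p * N.coord p.2 y := by
  rw [normal, signedCol, S.ip_lift_RD _ hy, N.ip_smul_left]
  rfl

lemma finrank_V : Module.finrank ℝ S.V = dimV m n := by
  rw [V, LinearMap.finrank_range_of_inj S.Vbasis_injective]
  simp

variable {S} in
/-- If the signed columns of a family `K` of `d` springs span, then the coordinates along these
springs parametrize `V`. -/
lemma exists_parametrization {K : Finset (SignedIndex m)}
    (hspan : Submodule.span ℝ (S.signedCol '' (K : Set (SignedIndex m))) = ⊤)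
    (hK : K.card = dimV m n) :
    ∃ B : (SignedIndex m → ℝ) →ₗ[ℝ] (Fin m → ℝ), (∀ g, B g ∈ S.V) ∧
      (∀ g, ∀ p ∈ K, N.coord p.2 (B g) = g p) ∧
      ∀ y ∈ S.V, ∀ g : SignedIndex m → ℝ, (∀ p ∈ K, N.coord p.2 y = g p) → B g = y := by
  let Φ : S.V →ₗ[ℝ] (K → ℝ) :=
    LinearMap.pi fun p => (N.coordL p.1.2).comp S.V.subtype
  have hinj : Function.Injective Φ := by
    rw [← LinearMap.ker_eq_bot, LinearMap.ker_eq_bot']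
    rintro ⟨y, hy⟩ h
    have h1 : ∀ p ∈ K, N.ip (S.normal p) y = 0 := fun p hp => by
      have := congrFun h ⟨p, hp⟩
      rw [S.ip_normal p hy]
      have h2 : N.coord p.2 y = 0 := this
      rw [h2, mul_zero]
    have h2 : ∀ z, N.ip (S.lift z) y = 0 := by
      intro z
      have hz : z ∈ Submodule.span ℝ (S.signedCol '' (K : Set (SignedIndex m))) := by
        rw [hspan]; trivial
      induction hz using Submodule.span_induction with
      | mem x hx => obtain ⟨p, hp, rfl⟩ := hx; exact h1 p hp
      | zero => simp [SpringNetwork.ip]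
      | add x y _ _ hx hy => rw [map_add, N.ip_add_left, hx, hy, add_zero]
      | smul r x _ hx => rw [map_smul, N.ip_smul_left, hx, mul_zero]
    -- The vector y is its own lift, hence A-orthogonal to itself.
    have h3 := h2 (S.RD *ᵥ y)
    rw [S.lift_RD hy] at h3
    exact Subtype.ext (N.eq_zero_of_ip_self h3)
  let E := LinearEquiv.ofInjectiveOfFinrankEq Φ hinj (by simp [finrank_V, hK])
  have hE : ∀ v, E v = Φ v := fun v => rfl
  -- The parametrization accepts functions on all signed indices and only reads their values on K.
  refine ⟨S.V.subtype ∘ₗ E.symm.toLinearMap ∘ₗ LinearMap.funLeft ℝ ℝ (fun p : K => p.1),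
    fun g => by simp, fun g p hp => ?_, fun y hy g hg => ?_⟩
  · have := hE (E.symm (LinearMap.funLeft ℝ ℝ (fun p : K => p.1) g))
    rw [LinearEquiv.apply_symm_apply] at this
    exact (congrFun this ⟨p, hp⟩).symm
  · have : LinearMap.funLeft ℝ ℝ (fun p : K => p.1) g = E ⟨y, hy⟩ := by
      rw [hE]
      ext p
      exact (hg p.1 p.2).symm
    simp [this]

end MoreauMatrices

end Elastoplastic

/-! ### Finitely generated cones: interior points and irreducibility. -/

namespace Elastoplastic

open Finset

/-- The conic hull of a finite family consists of its conic combinations. -/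
lemma mem_hull_image_finset_iff {ι E : Type*} [AddCommGroup E] [Module ℝ E] (g : ι → E)
    (I : Finset ι) (x : E) :
    x ∈ PointedCone.hull ℝ (g '' (I : Set ι)) ↔
      ∃ w : ι → ℝ, (∀ p, 0 ≤ w p) ∧ ∑ p ∈ I, w p • g p = x := by
  rw [PointedCone.hull, Submodule.mem_span_image_finset_iff_exists_fun']
  constructor
  · rintro ⟨c, rfl⟩
    exact ⟨fun p => (c p : ℝ), fun p => (c p).2, rfl⟩
  · rintro ⟨w, hw, rfl⟩
    exact ⟨fun p => ⟨w p, hw p⟩, rfl⟩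

/-- A point of the relative interior of a finitely generated cone is a combination of the
generators with positive coefficients. -/
lemma exists_pos_of_notMem_intrinsicFrontier {ι E : Type*} [AddCommGroup E] [Module ℝ E]
    [TopologicalSpace E] [IsTopologicalAddGroup E] [ContinuousSMul ℝ E] (g : ι → E)
    (I : Finset ι) {x : E} (hx : x ∈ PointedCone.hull ℝ (g '' (I : Set ι)))
    (hfr : x ∉ intrinsicFrontier ℝ (PointedCone.hull ℝ (g '' (I : Set ι)) : Set E)) :
    ∃ w : ι → ℝ, (∀ p, 0 < w p) ∧ ∑ p ∈ I, w p • g p = x := by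
  set K : Set E := (PointedCone.hull ℝ (g '' (I : Set ι)) : Set E) with hK
  have hint : x ∈ intrinsicInterior ℝ K := by
    rw [← intrinsicClosure_sdiff_intrinsicFrontier]
    exact ⟨subset_intrinsicClosure hx, hfr⟩
  obtain ⟨x', hx', rfl⟩ := mem_intrinsicInterior.1 hint
  have h0 : (0 : E) ∈ K := Submodule.zero_mem _
  have hs : ∑ p ∈ I, g p ∈ K :=
    Submodule.sum_mem _ fun p hp => PointedCone.subset_hull ⟨p, hp, rfl⟩
  have hmem : ∀ δ : ℝ, x'.1 - δ • ∑ p ∈ I, g p ∈ affineSpan ℝ K := fun δ => by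
    have := AffineSubspace.smul_vsub_vadd_mem (affineSpan ℝ K) δ
      (subset_affineSpan ℝ K h0) (subset_affineSpan ℝ K hs) x'.2
    convert this using 1
    simp only [vsub_eq_sub, vadd_eq_add, zero_sub, smul_neg]
    abel
  let γ : ℝ → affineSpan ℝ K := fun δ => ⟨x'.1 - δ • ∑ p ∈ I, g p, hmem δ⟩
  have hγ : Continuous γ := by
    apply Continuous.subtype_mk
    fun_prop
  have hγ0 : γ 0 = x' := by simp [γ]
  have hev : ∀ᶠ δ in nhds (0 : ℝ), γ δ ∈ interior ((↑) ⁻¹' K : Set (affineSpan ℝ K)) :=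
    hγ.continuousAt.eventually (by rw [hγ0]; exact isOpen_interior.mem_nhds hx')
  have hev2 : ∀ᶠ δ in nhdsWithin (0 : ℝ) (Set.Ioi 0),
      γ δ ∈ interior ((↑) ⁻¹' K : Set (affineSpan ℝ K)) := hev.filter_mono nhdsWithin_le_nhds
  obtain ⟨δ, hδ, hδ0⟩ := (hev2.and self_mem_nhdsWithin).exists
  -- Relative interiority leaves room to subtract a small δ times the sum of all generators; adding
  -- it back makes every coefficient at least δ.
  have hδK : x'.1 - δ • ∑ p ∈ I, g p ∈ K := (interior_subset hδ :)
  obtain ⟨w, hw, hsum⟩ := (mem_hull_image_finset_iff g I _).1 hδK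
  refine ⟨fun p => w p + δ, fun p => add_pos_of_nonneg_of_pos (hw p) hδ0, ?_⟩
  simp only [add_smul, sum_add_distrib, hsum, ← smul_sum]
  abel

/-- If a family is linearly dependent, one of its members can be dropped from any conic
combination. -/
lemma exists_mem_hull_erase {ι E : Type*} [DecidableEq ι] [AddCommGroup E] [Module ℝ E]
    (g : ι → E) (I : Finset ι) (hdep : ¬ LinearIndepOn ℝ g (I : Set ι)) {x : E}
    (hx : x ∈ PointedCone.hull ℝ (g '' (I : Set ι))) :
    ∃ q ∈ I, x ∈ PointedCone.hull ℝ (g '' ((I.erase q : Finset ι) : Set ι)) := by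
  obtain ⟨w, hw, rfl⟩ := (mem_hull_image_finset_iff g I _).1 hx
  have : ∃ f : ι → ℝ, ∑ p ∈ I, f p • g p = 0 ∧ ∃ i ∈ I, 0 < f i := by
    rw [linearIndepOn_finset_iff] at hdep
    push Not at hdep
    obtain ⟨f, hf, i, hi, hne⟩ := hdep
    rcases lt_or_gt_of_ne hne with h | h
    · exact ⟨-f, by simp [hf], i, hi, by simpa using h⟩
    · exact ⟨f, hf, i, hi, h⟩
  obtain ⟨f, hf, i, hi, hpos⟩ := this
  -- Carathéodory's reduction: subtract the dependence f, scaled by the smallest ratio w/f, so that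
  -- the coefficient of q vanishes and no other becomes negative.
  obtain ⟨q, hq, hmin⟩ := exists_min_image (I.filter fun p => 0 < f p) (fun p => w p / f p)
    ⟨i, mem_filter.2 ⟨hi, hpos⟩⟩
  obtain ⟨hqI, hfq⟩ := mem_filter.1 hq
  refine ⟨q, hqI, ?_⟩
  have hnn : ∀ p ∈ I, 0 ≤ w p - w q / f q * f p := fun p hp => by
    by_cases hfp : 0 < f p
    · have := hmin p (mem_filter.2 ⟨hp, hfp⟩)
      rw [div_le_div_iff₀ hfq hfp] at this
      rw [sub_nonneg, div_mul_eq_mul_div, div_le_iff₀ hfq]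
      exact this
    · have : w q / f q * f p ≤ 0 :=
        mul_nonpos_of_nonneg_of_nonpos (div_nonneg (hw q) hfq.le) (not_lt.1 hfp)
      linarith [hw p]
  have hsum : ∑ p ∈ I, w p • g p = ∑ p ∈ I.erase q, (w p - w q / f q * f p) • g p := by
    have h1 : ∑ p ∈ I, (w p - w q / f q * f p) • g p = ∑ p ∈ I, w p • g p := by
      simp only [sub_smul, sum_sub_distrib, mul_smul, ← smul_sum, hf, smul_zero, sub_zero]
    rw [← h1, ← sum_erase_add _ _ hqI]
    simp [div_mul_cancel₀ _ hfq.ne']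
  rw [hsum]
  refine Submodule.sum_mem _ fun p hp => ?_
  exact (PointedCone.hull ℝ _).smul_mem (hnn p (mem_of_mem_erase hp))
    (PointedCone.subset_hull ⟨p, hp, rfl⟩)

namespace MoreauMatrices

variable {m n : ℕ} {N : SpringNetwork m n} {S : MoreauMatrices N}

lemma StrictConeInclusion.exists_pos {l₁ : ℝ} {I : Finset (SignedIndex m)}
    (h : S.StrictConeInclusion l₁ I) :
    ∃ w : SignedIndex m → ℝ, (∀ p, 0 < w p) ∧
      ∑ p ∈ I, w p • S.signedCol p = l₁ • firstVec m n :=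
  exists_pos_of_notMem_intrinsicFrontier _ _ h.1 h.2

lemma Irreducible.linearIndepOn {l₁ : ℝ} {I : Finset (SignedIndex m)}
    (h : S.Irreducible l₁ I) (hI : S.ConeInclusion l₁ I) :
    LinearIndepOn ℝ S.signedCol (I : Set (SignedIndex m)) := by
  by_contra hdep
  obtain ⟨q, hq, hmem⟩ := exists_mem_hull_erase _ _ hdep hI
  exact h ⟨I.erase q, q, notMem_erase q I, (insert_erase hq).symm, hmem⟩

lemma span_signedCol_of_rank {K : Finset (SignedIndex m)}
    (h : (S.signedColMatrix K).rank = dimV m n) :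
    Submodule.span ℝ (S.signedCol '' (K : Set (SignedIndex m))) = ⊤ := by
  rw [Matrix.rank_eq_finrank_span_cols] at h
  have hr : Set.range (S.signedColMatrix K).col = S.signedCol '' (K : Set (SignedIndex m)) := by
    rw [Set.image_eq_range]
    rfl
  rw [hr] at h
  exact Submodule.eq_top_of_finrank_eq (by simpa using h)

/-- In both cases of the definition of the index families, the signed columns of `I₀ ∪ I₁` form a
basis. -/
lemma span_signedCol_union {l₁ : ℝ} {I₀ I₁ : Finset (SignedIndex m)}
    (hcone : S.ConeInclusion l₁ I₀) (hcard : I₀.card + I₁.card = dimV m n)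
    (hirr : I₀.card = dimV m n → S.Irreducible l₁ I₀)
    (hrank : I₀.card < dimV m n → (S.signedColMatrix (I₀ ∪ I₁)).rank = dimV m n) :
    Submodule.span ℝ (S.signedCol '' ((I₀ ∪ I₁ : Finset _) : Set (SignedIndex m))) = ⊤ ∧
      (I₀ ∪ I₁).card = dimV m n := by
  rcases (show I₀.card ≤ dimV m n by omega).lt_or_eq with hlt | heq
  · have h := hrank hlt
    refine ⟨span_signedCol_of_rank h, le_antisymm (hcard ▸ card_union_le _ _) ?_⟩
    -- Rank d needs at least d columns, so the union has exactly d elements; this later forces `I₀`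
    -- and `I₁` to be disjoint.
    have := Matrix.rank_le_card_width (S.signedColMatrix (I₀ ∪ I₁))
    rw [h, Fintype.card_coe] at this
    exact this
  · obtain rfl : I₁ = ∅ := card_eq_zero.1 (by omega)
    rw [union_empty]
    refine ⟨?_, heq⟩
    have hli := (hirr heq).linearIndepOn hcone
    rw [Set.image_eq_range]
    exact LinearIndependent.span_eq_top_of_card_eq_finrank' hli (by simp [heq])

end MoreauMatrices

end Elastoplastic

/-! ### The facet as a box: vertices, admissibility and the gap estimate. -/

namespace Elastoplastic

open Finset

/-- The signed index `(-α, j)`. -/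
def SignedIndex.flip {m : ℕ} (p : SignedIndex m) : SignedIndex m := (-p.1, p.2)

lemma mem_flips {m : ℕ} {I₁ I : Finset (SignedIndex m)} :
    I ∈ flips I₁ ↔ ∃ T ⊆ I₁, (I₁ \ T) ∪ T.image SignedIndex.flip = I := by
  simp only [flips, mem_image, mem_powerset]
  rfl

lemma exists_of_mem_flips {m : ℕ} {I₁ I : Finset (SignedIndex m)} (hI : I ∈ flips I₁)
    {q : SignedIndex m} (hq : q ∈ I) : ∃ p ∈ I₁, q = p ∨ q = p.flip := by
  obtain ⟨T, hT, rfl⟩ := mem_flips.1 hI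
  rcases mem_union.1 hq with h | h
  · exact ⟨q, (mem_sdiff.1 h).1, Or.inl rfl⟩
  · obtain ⟨p, hp, rfl⟩ := mem_image.1 h
    exact ⟨p, hT hp, Or.inr rfl⟩

lemma self_mem_flips {m : ℕ} (I₁ : Finset (SignedIndex m)) : I₁ ∈ flips I₁ :=
  mem_flips.2 ⟨∅, empty_subset _, by simp⟩

lemma image_flip_mem_flips {m : ℕ} (I₁ : Finset (SignedIndex m)) :
    I₁.image SignedIndex.flip ∈ flips I₁ :=
  mem_flips.2 ⟨I₁, Subset.rfl, by simp⟩

namespace SpringNetwork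

variable {m n : ℕ} (N : SpringNetwork m n)

lemma limit_mem (p : SignedIndex m) : N.limit p ∈ Set.Icc (N.cMinus p.2) (N.cPlus p.2) := by
  unfold limit
  split_ifs
  · exact ⟨N.c_le _, le_rfl⟩
  · exact ⟨le_rfl, N.c_le _⟩

lemma sgn_mul_le_iff (p : SignedIndex m) (r : ℝ) :
    (sgn p * r ≤ sgn p * N.limit p ∧ sgn p.flip * r ≤ sgn p.flip * N.limit p.flip) ↔
      r ∈ Set.Icc (N.cMinus p.2) (N.cPlus p.2) := by
  obtain ⟨u, j⟩ := p
  have h : (-1 : ℤˣ) ≠ 1 := by decide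
  rcases Int.units_eq_one_or u with rfl | rfl <;>
    simp [sgn, SignedIndex.flip, limit, and_comm, h]

lemma insert_limit_flip (p : SignedIndex m) :
    ({N.limit p, N.limit p.flip} : Set ℝ) = {N.cMinus p.2, N.cPlus p.2} := by
  obtain ⟨u, j⟩ := p
  have h : (-1 : ℤˣ) ≠ 1 := by decide
  rcases Int.units_eq_one_or u with rfl | rfl <;>
    simp [SignedIndex.flip, limit, h, Set.pair_comm]

end SpringNetwork

namespace MoreauMatrices

variable {m n : ℕ} {N : SpringNetwork m n} (S : MoreauMatrices N)

/-- `B` parametrizes `V` by the values of the stresses of the springs in `K`. -/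
structure IsParametrization (K : Finset (SignedIndex m))
    (B : (SignedIndex m → ℝ) →ₗ[ℝ] (Fin m → ℝ)) : Prop where
  mem : ∀ g, B g ∈ S.V
  coord : ∀ g, ∀ p ∈ K, N.coord p.2 (B g) = g p
  eq_of_coord : ∀ y ∈ S.V, ∀ g : SignedIndex m → ℝ, (∀ p ∈ K, N.coord p.2 y = g p) → B g = y

variable (N) in
/-- The stresses at the vertex obtained by flipping the signs of the family `T`. -/
noncomputable def cornerValue (T : Finset (SignedIndex m)) (p : SignedIndex m) : ℝ :=
  if p ∈ T then N.limit p.flip else N.limit p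

variable {S}

lemma mem_C_iff {y : Fin m → ℝ} :
    y ∈ S.C ↔ y ∈ S.V ∧ ∀ j, N.coord j y ∈ Set.Icc (N.cMinus j) (N.cPlus j) := by
  simp only [C, Set.mem_ofPred_eq, halfSpace, Set.mem_inter_iff]
  refine and_congr_right fun hy => forall_congr' fun j => ?_
  rw [← N.sgn_mul_le_iff (-1, j)]
  simp [hy, SignedIndex.flip]

/-- The two families `I₁` and `I₁` with all signs reversed already impose both limits on each
spring; the remaining families add nothing. -/
lemma mem_F_iff {I₀ I₁ : Finset (SignedIndex m)} {y : Fin m → ℝ} :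
    y ∈ S.F I₀ I₁ ↔ y ∈ S.V ∧ (∀ p ∈ I₀, N.coord p.2 y = N.limit p) ∧
      ∀ p ∈ I₁, N.coord p.2 y ∈ Set.Icc (N.cMinus p.2) (N.cPlus p.2) := by
  constructor
  · rintro ⟨hy, h0, h1⟩
    refine ⟨hy, fun p hp => (h0 p hp).2, fun p hp => ?_⟩
    rw [← N.sgn_mul_le_iff]
    exact ⟨(h1 _ (self_mem_flips I₁) p hp).2,
      (h1 _ (image_flip_mem_flips I₁) p.flip (mem_image_of_mem _ hp)).2⟩
  · rintro ⟨hy, h0, h1⟩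
    refine ⟨hy, fun p hp => ⟨hy, h0 p hp⟩, fun I hI q hq => ⟨hy, ?_⟩⟩
    obtain ⟨p, hp, h⟩ := exists_of_mem_flips hI hq
    have := (N.sgn_mul_le_iff p _).2 (h1 p hp)
    rcases h with rfl | rfl
    · exact this.1
    · exact this.2

section Parametrization

variable {I₀ I₁ : Finset (SignedIndex m)} {B : (SignedIndex m → ℝ) →ₗ[ℝ] (Fin m → ℝ)}

/-- Flipping a sign changes which limit is prescribed, not which spring, so the same coordinates
determine every vertex. -/
lemma IsParametrization.hyperplanes_eq (hB : S.IsParametrization (I₀ ∪ I₁) B)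
    (hdisj : Disjoint I₀ I₁) {T : Finset (SignedIndex m)} (hT : T ⊆ I₁) :
    S.hyperplanes (I₀ ∪ ((I₁ \ T) ∪ T.image SignedIndex.flip)) = {B (cornerValue N T)} := by
  have h0T : ∀ p ∈ I₀, p ∉ T := fun p hp hpT => disjoint_left.1 hdisj hp (hT hpT)
  ext y
  constructor
  · rintro ⟨hy, h⟩
    refine (hB.eq_of_coord y hy _ fun p hp => ?_).symm
    unfold cornerValue
    split_ifs with hpT
    · exact (h p.flip (mem_union_right _ (mem_union_right _ (mem_image_of_mem _ hpT)))).2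
    · rcases mem_union.1 hp with hp | hp
      · exact (h p (mem_union_left _ hp)).2
      · exact (h p (mem_union_right _ (mem_union_left _ (mem_sdiff.2 ⟨hp, hpT⟩)))).2
  · rintro rfl
    refine ⟨hB.mem _, fun p hp => ⟨hB.mem _, ?_⟩⟩
    rcases mem_union.1 hp with hp | hp
    · rw [hB.coord _ p (mem_union_left _ hp), cornerValue, if_neg (h0T p hp)]
    rcases mem_union.1 hp with hp | hp
    · obtain ⟨hp1, hpT⟩ := mem_sdiff.1 hp
      rw [hB.coord _ p (mem_union_right _ hp1), cornerValue, if_neg hpT]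
    · obtain ⟨q, hq, rfl⟩ := mem_image.1 hp
      have := hB.coord (cornerValue N T) q (mem_union_right _ (hT hq))
      rw [cornerValue, if_pos hq] at this
      exact this

lemma vertex_eq_of_hyperplanes {K : Finset (SignedIndex m)} {y : Fin m → ℝ}
    (h : S.hyperplanes K = {y}) : S.vertex K = y := by
  have : S.vertex K ∈ S.hyperplanes K :=
    Classical.epsilon_spec (p := fun y => y ∈ S.hyperplanes K) ⟨y, by rw [h]; rfl⟩
  rw [h] at this
  exact this

lemma IsParametrization.hyperplanes_eq_vertex (hB : S.IsParametrization (I₀ ∪ I₁) B)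
    (hdisj : Disjoint I₀ I₁) {I : Finset (SignedIndex m)} (hI : I ∈ flips I₁) :
    S.hyperplanes (I₀ ∪ I) = {S.vertex (I₀ ∪ I)} := by
  obtain ⟨T, hT, rfl⟩ := mem_flips.1 hI
  have := hB.hyperplanes_eq hdisj hT
  rw [vertex_eq_of_hyperplanes this, this]

lemma IsParametrization.F_nonempty (hB : S.IsParametrization (I₀ ∪ I₁) B) :
    (S.F I₀ I₁).Nonempty :=
  ⟨B N.limit, mem_F_iff.2 ⟨hB.mem _, fun p hp => hB.coord _ p (mem_union_left _ hp), fun p hp => by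
    rw [hB.coord _ p (mem_union_right _ hp)]; exact N.limit_mem p⟩⟩

/-- The facet is spanned by its vertices. -/
lemma IsParametrization.F_subset_convexHull (hB : S.IsParametrization (I₀ ∪ I₁) B)
    (hdisj : Disjoint I₀ I₁) :
    S.F I₀ I₁ ⊆ convexHull ℝ {x | ∃ I ∈ flips I₁, x = S.vertex (I₀ ∪ I)} := by
  intro y hy
  obtain ⟨hyV, h0, h1⟩ := mem_F_iff.1 hy
  let s : SignedIndex m → Set ℝ := fun p =>
    if p ∈ I₁ then {N.cMinus p.2, N.cPlus p.2} else {N.limit p}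
  let g : SignedIndex m → ℝ := fun p => if p ∈ I₁ then N.coord p.2 y else N.limit p
  have hg : B g = y := by
    refine hB.eq_of_coord y hyV g fun p hp => ?_
    by_cases hp1 : p ∈ I₁
    · simp [g, hp1]
    · have := h0 p ((mem_union.1 hp).resolve_right hp1)
      simp [g, hp1, this]
  -- In coordinates, F is a product of segments and points, and the convex hull of a product of sets
  -- is the product of their hulls.
  have hgs : g ∈ convexHull ℝ (Set.univ.pi s) := by
    rw [convexHull_pi]
    intro p _
    by_cases hp1 : p ∈ I₁
    · simp only [s, g, if_pos hp1]
      rw [convexHull_pair, segment_eq_Icc (N.c_le _)]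
      exact h1 p hp1
    · simp [s, g, if_neg hp1]
  rw [← hg]
  have himg : B g ∈ convexHull ℝ (B '' Set.univ.pi s) := by
    rw [← LinearMap.image_convexHull]
    exact Set.mem_image_of_mem _ hgs
  refine convexHull_mono ?_ himg
  rintro _ ⟨v, hv, rfl⟩
  -- Each corner of the box is a vertex: T collects the indices at which it takes the opposite
  -- limit.
  let T : Finset (SignedIndex m) := I₁.filter fun p => v p ≠ N.limit p
  have hv' : v = cornerValue N T := by
    ext p
    have hvp : v p ∈ s p := hv p trivial
    by_cases hp1 : p ∈ I₁
    · simp only [s, if_pos hp1] at hvp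
      rw [← N.insert_limit_flip] at hvp
      by_cases hp2 : v p = N.limit p
      · simp [cornerValue, T, hp2]
      · rw [cornerValue, if_pos (mem_filter.2 ⟨hp1, hp2⟩)]
        exact hvp.resolve_left hp2
    · simp only [s, if_neg hp1] at hvp
      rw [cornerValue, if_neg fun h => hp1 (mem_filter.1 h).1]
      exact hvp
  have hT : T ⊆ I₁ := filter_subset _ _
  refine ⟨_, mem_flips.2 ⟨T, hT, rfl⟩, ?_⟩
  rw [vertex_eq_of_hyperplanes (hB.hyperplanes_eq hdisj hT), hv']

/-- Under the feasibility condition the facet consists of admissible states. -/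
lemma IsParametrization.F_subset_C (hB : S.IsParametrization (I₀ ∪ I₁) B)
    (hdisj : Disjoint I₀ I₁) (hfeas : S.Feasible I₀ I₁) : S.F I₀ I₁ ⊆ S.C := by
  intro y hy
  obtain ⟨hyV, h0, h1⟩ := mem_F_iff.1 hy
  refine mem_C_iff.2 ⟨hyV, fun j => ?_⟩
  by_cases hj0 : ∃ p ∈ I₀, p.2 = j
  · obtain ⟨p, hp, rfl⟩ := hj0
    rw [h0 p hp]
    exact N.limit_mem p
  by_cases hj1 : ∃ p ∈ I₁, p.2 = j
  · obtain ⟨p, hp, rfl⟩ := hj1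
    exact h1 p hp
  push Not at hj0 hj1
  have hsub : convexHull ℝ {x | ∃ I ∈ flips I₁, x = S.vertex (I₀ ∪ I)} ⊆
      N.coordL j ⁻¹' Set.Icc (N.cMinus j) (N.cPlus j) := by
    refine convexHull_min ?_ ((convex_Icc _ _).linear_preimage _)
    rintro _ ⟨I, hI, rfl⟩
    have := hfeas I hI j hj0 fun I' hI' q hq => by
      obtain ⟨p, hp, h⟩ := exists_of_mem_flips hI' hq
      rcases h with rfl | rfl
      · exact hj1 _ hp
      · exact hj1 p hp
    exact ⟨this.1.le, this.2.le⟩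
  exact hsub (hB.F_subset_convexHull hdisj hy)

/-- The energy gap `⟨u, A (z - x)⟩` between a state `x ∈ C` and the facet controls the distance
from `x` to the facet, if `u` is a positive combination of the normals of `I₀`. -/
lemma IsParametrization.exists_gap_bound (hB : S.IsParametrization (I₀ ∪ I₁) B)
    (hdisj : Disjoint I₀ I₁) {w : SignedIndex m → ℝ} (hw : ∀ p, 0 < w p) {u : Fin m → ℝ}
    (hu : u = ∑ p ∈ I₀, w p • S.normal p) :
    ∃ Q > 0, ∀ x ∈ S.C, ∃ z ∈ S.F I₀ I₁, (∀ y ∈ S.F I₀ I₁, N.ip u (y - x) = N.ip u (z - x)) ∧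
      0 ≤ N.ip u (z - x) ∧ N.ip (x - z) (x - z) ≤ Q * N.ip u (z - x) ^ 2 := by
  let B' := LinearMap.toContinuousLinearMap B
  let κ : ℝ := ∑ p, (w p)⁻¹
  have hκ : 0 ≤ κ := sum_nonneg fun p _ => (inv_pos.2 (hw p)).le
  have ha : 0 ≤ ∑ j, N.a j := sum_nonneg fun j _ => (N.a_pos j).le
  -- The first term compares the energy norm with the sup norm through ‖B‖ and the weights; the
  -- summand 1 only keeps Q positive.
  refine ⟨(∑ j, N.a j) * (‖B'‖ * κ) ^ 2 + 1, by positivity, fun x hx => ?_⟩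
  obtain ⟨hxV, hxc⟩ := mem_C_iff.1 hx
  -- The excess over the limits on `I₀`, zero elsewhere: `x - B h` puts the `I₀`-stresses at their
  -- limits and keeps those of `I₁`.
  let h : SignedIndex m → ℝ := fun p => if p ∈ I₀ then N.coord p.2 x - N.limit p else 0
  let gap : SignedIndex m → ℝ := fun p => sgn p * (N.limit p - N.coord p.2 x)
  have hgap : ∀ p, 0 ≤ gap p := fun p => by
    have := ((N.sgn_mul_le_iff p _).2 (hxc p.2)).1
    simp only [gap, mul_sub]
    linarith
  have hz : x - B h ∈ S.F I₀ I₁ := by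
    refine mem_F_iff.2 ⟨S.V.sub_mem hxV (hB.mem _), fun p hp => ?_, fun p hp => ?_⟩
    · rw [N.coord_sub, hB.coord _ p (mem_union_left _ hp)]
      simp [h, hp]
    · rw [N.coord_sub, hB.coord _ p (mem_union_right _ hp)]
      simpa [h, disjoint_right.1 hdisj hp] using hxc p.2
  have hip : ∀ y ∈ S.F I₀ I₁, N.ip u (y - x) = ∑ p ∈ I₀, w p * gap p := by
    intro y hy
    obtain ⟨hyV, h0, -⟩ := mem_F_iff.1 hy
    rw [hu, N.ip_sum_left]
    refine sum_congr rfl fun p hp => ?_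
    rw [N.ip_smul_left, S.ip_normal p (S.V.sub_mem hyV hxV), N.coord_sub, h0 p hp]
  have hle : ∀ p ∈ I₀, w p * gap p ≤ ∑ p ∈ I₀, w p * gap p := fun p hp =>
    single_le_sum (f := fun p => w p * gap p) (fun q _ => mul_nonneg (hw q).le (hgap q)) hp
  have hpos : 0 ≤ ∑ p ∈ I₀, w p * gap p :=
    sum_nonneg fun p _ => mul_nonneg (hw p).le (hgap p)
  refine ⟨x - B h, hz, fun y hy => by rw [hip y hy, hip _ hz], by rw [hip _ hz]; exact hpos, ?_⟩
  rw [hip _ hz, sub_sub_cancel]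
  set φ := ∑ p ∈ I₀, w p * gap p
  have hh : ‖h‖ ≤ κ * φ := by
    refine (pi_norm_le_iff_of_nonneg (mul_nonneg hκ hpos)).2 fun p => ?_
    by_cases hp : p ∈ I₀
    · have h1 : |h p| = gap p := by
        have : h p = -(sgn p * gap p) := by
          simp only [h, if_pos hp, gap, ← mul_assoc, sgn_mul_self]
          ring
        have hs : |sgn p| = 1 := by
          have := sgn_mul_self p
          rw [← abs_mul_abs_self] at this
          nlinarith [abs_nonneg (sgn p)]
        rw [this, abs_neg, abs_mul, hs, one_mul, abs_of_nonneg (hgap p)]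
      rw [Real.norm_eq_abs, h1]
      have h2 : gap p ≤ (w p)⁻¹ * φ := by
        rw [inv_mul_eq_div, le_div_iff₀ (hw p), mul_comm]
        exact hle p hp
      refine h2.trans (mul_le_mul_of_nonneg_right ?_ hpos)
      exact single_le_sum (f := fun p => (w p)⁻¹) (fun q _ => (inv_pos.2 (hw q)).le) (mem_univ p)
    · simp only [h, if_neg hp, norm_zero]
      exact mul_nonneg hκ hpos
  have hBh : ‖B h‖ ≤ ‖B'‖ * κ * φ := by
    refine (B'.le_opNorm h).trans ?_
    rw [mul_assoc]
    exact mul_le_mul_of_nonneg_left hh (norm_nonneg _)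
  calc N.ip (B h) (B h) = ∑ j, N.a j * (B h j) ^ 2 := by
        rw [N.ip_eq_sum]
        exact sum_congr rfl fun j _ => by ring
    _ ≤ ∑ j, N.a j * (‖B'‖ * κ * φ) ^ 2 := by
        refine sum_le_sum fun j _ => mul_le_mul_of_nonneg_left ?_ (N.a_pos j).le
        rw [← sq_abs]
        exact pow_le_pow_left₀ (abs_nonneg _) ((norm_le_pi_norm (B h) j).trans hBh) 2
    _ = (∑ j, N.a j) * (‖B'‖ * κ) ^ 2 * φ ^ 2 := by rw [← sum_mul]; ring
    _ ≤ _ := by nlinarith [sq_nonneg φ]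

/-- The inclusion `u + B_ε(0) ∩ N_F(y) ⊆ N_C(y)` for a positive combination `u` of the normals of
`I₀`. -/
lemma IsParametrization.exists_add_mem_normalCone (hB : S.IsParametrization (I₀ ∪ I₁) B)
    (hdisj : Disjoint I₀ I₁) (hFC : S.F I₀ I₁ ⊆ S.C) {w : SignedIndex m → ℝ}
    (hw : ∀ p, 0 < w p) {u : Fin m → ℝ} (hu : u = ∑ p ∈ I₀, w p • S.normal p) :
    ∃ ε > 0, ∀ y ∈ S.F I₀ I₁, ∀ ξ ∈ S.normalCone (S.F I₀ I₁) y, N.normA ξ ≤ ε →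
      u + ξ ∈ S.normalCone S.C y := by
  obtain ⟨Q, hQ, hgap⟩ := hB.exists_gap_bound hdisj hw hu
  have huV : u ∈ S.V := by
    rw [hu]
    exact S.V.sum_mem fun p _ => S.V.smul_mem _ (S.normal_mem p)
  refine ⟨(√Q)⁻¹, inv_pos.2 (Real.sqrt_pos.2 hQ), fun y hy ξ hξ hε => ?_⟩
  refine ⟨hFC hy, S.V.add_mem huV hξ.2.1, fun η hη => ?_⟩
  obtain ⟨z, hz, heq, hnn, hle⟩ := hgap η hη
  have h1 : N.ip ξ (z - y) ≤ 0 := hξ.2.2 z hz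
  have h2 : N.ip u (η - y) = -N.ip u (z - η) := by
    rw [← heq y hy, N.ip_sub_right, N.ip_sub_right]
    ring
  -- By Cauchy–Schwarz this is at most ε √Q φ = φ, which the term -φ coming from u absorbs.
  have h3 : N.ip ξ (η - z) ≤ N.ip u (z - η) := by
    refine le_of_sq_le_sq ?_ hnn
    have hξξ : N.ip ξ ξ ≤ Q⁻¹ := by
      have := pow_le_pow_left₀ (Real.sqrt_nonneg _) hε 2
      rwa [Real.sq_sqrt (N.ip_self_nonneg ξ), inv_pow, Real.sq_sqrt hQ.le] at this
    calc N.ip ξ (η - z) ^ 2 ≤ N.ip ξ ξ * N.ip (η - z) (η - z) := N.ip_sq_le _ _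
      _ ≤ Q⁻¹ * (Q * N.ip u (z - η) ^ 2) :=
        mul_le_mul hξξ hle (N.ip_self_nonneg _) (inv_nonneg.2 hQ.le)
      _ = N.ip u (z - η) ^ 2 := by rw [← mul_assoc, inv_mul_cancel₀ hQ.ne', one_mul]
  have h4 : η - y = (η - z) + (z - y) := by abel
  rw [N.ip_add_left, h2]
  nth_rewrite 1 [h4]
  rw [N.ip_add_right]
  linarith

end Parametrization

end MoreauMatrices

end Elastoplastic

/-! ### Absolutely continuous solutions and convergence in finite time. -/

namespace Elastoplastic

open Finset

lemma _root_.AbsolutelyContinuousOnInterval.clm_comp {E : Type*} [NormedAddCommGroup E]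
    [NormedSpace ℝ E] {f : ℝ → E} {a b : ℝ} (hf : AbsolutelyContinuousOnInterval f a b)
    (φ : E →L[ℝ] ℝ) : AbsolutelyContinuousOnInterval (fun t => φ (f t)) a b := by
  have h := Filter.Tendsto.const_mul ‖φ‖ hf
  rw [mul_zero] at h
  refine squeeze_zero (fun E => sum_nonneg fun i _ => dist_nonneg) (fun E => ?_) h
  rw [mul_sum]
  exact sum_le_sum fun i _ => φ.lipschitz.dist_le_mul _ _

lemma _root_.AbsolutelyContinuousOnInterval.sub_le_of_deriv_le {f : ℝ → ℝ} {a b k : ℝ}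
    (hab : a ≤ b) (hf : AbsolutelyContinuousOnInterval f a b)
    (hd : ∀ᵐ t ∂(volume.restrict (Set.Icc a b)), deriv f t ≤ k) : f b - f a ≤ k * (b - a) := by
  rw [← hf.integral_deriv_eq_sub]
  have := intervalIntegral.integral_mono_ae_restrict hab hf.intervalIntegrable_deriv
    (intervalIntegrable_const (c := k)) hd
  rw [intervalIntegral.integral_const, smul_eq_mul] at this
  linarith

/-- A nonnegative function which decreases at least at rate `δ` as long as it is positive vanishes
after a finite time. -/
lemma eq_zero_of_deriv_le {f : ℝ → ℝ} {δ τ : ℝ} (hτ : f 0 < δ * τ) (hτ0 : 0 ≤ τ)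
    (hf : AbsolutelyContinuousOnInterval f 0 τ) (hnn : 0 ≤ f τ)
    (hd : ∀ᵐ t ∂(volume.restrict (Set.Ici (0 : ℝ))), deriv f t ≤ 0)
    (hpos : ∀ᵐ t ∂(volume.restrict (Set.Ici (0 : ℝ))), 0 < f t → deriv f t ≤ -δ) : f τ = 0 := by
  by_contra hne
  have hfτ : 0 < f τ := lt_of_le_of_ne hnn (Ne.symm hne)
  -- As f is nonincreasing, positivity at τ spreads to all of [0, τ], so the rate δ applies
  -- throughout and would make f τ negative.
  have hge : ∀ s ∈ Set.Icc 0 τ, f τ ≤ f s := fun s hs => by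
    have := (hf.mono (c := s) (d := τ) (by
      rw [Set.uIcc_of_le hs.2, Set.uIcc_of_le hτ0]
      exact Set.Icc_subset_Icc_left hs.1)).sub_le_of_deriv_le (k := 0) hs.2
      (ae_restrict_of_ae_restrict_of_subset (fun t ht => hs.1.trans ht.1) hd)
    linarith
  have := hf.sub_le_of_deriv_le (k := -δ) hτ0 (by
    filter_upwards [ae_restrict_of_ae_restrict_of_subset (fun t ht => ht.1) hpos,
      ae_restrict_mem measurableSet_Icc] with t ht htm
    exact ht (hfτ.trans_le (hge t htm)))
  linarith

/-- A function with constant right derivative is affine. -/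
lemma eq_affine_of_hasDerivWithinAt {l : ℝ → ℝ} {l₁ : ℝ}
    (hl : ∀ t, 0 ≤ t → HasDerivWithinAt l l₁ (Set.Ici 0) t) {t : ℝ} (ht : 0 ≤ t) :
    l t = l 0 + l₁ * t := by
  have hg : ∀ s, 0 ≤ s → HasDerivWithinAt (fun s => l s - l₁ * s) 0 (Set.Ici 0) s := fun s hs => by
    have := (hl s hs).sub ((hasDerivAt_id s).const_mul l₁).hasDerivWithinAt
    rw [mul_one, sub_self] at this
    exact this
  have := constant_of_has_deriv_right_zero (f := fun s => l s - l₁ * s) (a := 0) (b := t)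
    (fun s hs => ((hg s hs.1).continuousWithinAt).mono Set.Icc_subset_Ici_self)
    (fun s hs => (hg s hs.1).mono (Set.Ici_subset_Ici.2 hs.1)) t ⟨ht, le_rfl⟩
  simp only [mul_zero, sub_zero] at this
  linarith

lemma ae_pos_of_nonneg : ∀ᵐ t ∂(volume.restrict (Set.Ici (0 : ℝ))), 0 < t := by
  rw [← restrict_Ioi_eq_restrict_Ici]
  exact ae_restrict_mem measurableSet_Ioi

namespace MoreauMatrices

variable {m n : ℕ} {N : SpringNetwork m n} {S : MoreauMatrices N}

variable (S) in
lemma isClosed_C : IsClosed S.C := by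
  have : S.C = (S.V : Set (Fin m → ℝ)) ∩
      ⋂ j, N.coordL j ⁻¹' Set.Icc (N.cMinus j) (N.cPlus j) := by
    ext y
    rw [mem_C_iff]
    simp
  rw [this]
  exact S.V.closed_of_finiteDimensional.inter (isClosed_iInter fun j =>
    isClosed_Icc.preimage (N.coordL j).continuous_of_finiteDimensional)

variable (S) in
lemma exists_ip_bound (u : Fin m → ℝ) : ∃ b, ∀ x ∈ S.C, -N.ip u x ≤ b := by
  refine ⟨∑ j, |u j| * (|N.cMinus j| + |N.cPlus j|), fun x hx => ?_⟩
  rw [N.ip_eq_sum, ← sum_neg_distrib]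
  refine sum_le_sum fun j _ => ?_
  have h := (mem_C_iff.1 hx).2 j
  have h1 : -(N.a j * u j * x j) = -(u j * N.coord j x) := by rw [N.coord_eq]; ring
  rw [h1]
  refine (neg_le_abs _).trans ?_
  rw [abs_mul]
  refine mul_le_mul_of_nonneg_left ?_ (abs_nonneg _)
  rw [abs_le]
  constructor
  · linarith [h.1, neg_abs_le (N.cMinus j), abs_nonneg (N.cPlus j)]
  · linarith [h.2, le_abs_self (N.cPlus j), abs_nonneg (N.cMinus j)]

lemma hasDerivAt_c {l₁ : ℝ} (hl : ∀ t, 0 ≤ t → HasDerivWithinAt N.l l₁ (Set.Ici 0) t)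
    {t : ℝ} (ht : 0 < t) : HasDerivAt S.c (-(l₁ • (S.Vbasis *ᵥ S.Lbar))) t :=
  (((hl t ht.le).hasDerivAt (Ici_mem_nhds ht)).smul_const _).neg

lemma facetCondition_of_forall {l₁ : ℝ}
    (hl : ∀ t, 0 ≤ t → HasDerivWithinAt N.l l₁ (Set.Ici 0) t) {F : Set (Fin m → ℝ)} {ε : ℝ}
    (h : ∀ y ∈ F, ∀ ξ ∈ S.normalCone F y, N.normA ξ ≤ ε →
      l₁ • (S.Vbasis *ᵥ S.Lbar) + ξ ∈ S.normalCone S.C y) (τ : ℝ) :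
    S.FacetCondition F ε τ := by
  filter_upwards [ae_restrict_of_ae_restrict_of_subset Set.Icc_subset_Ici_self ae_pos_of_nonneg]
    with t ht
  have hd := hasDerivAt_c (S := S) hl ht
  refine ⟨hd.differentiableAt, fun y hy ξ hξ hε => ?_⟩
  rw [hd.deriv, neg_neg]
  exact h y hy ξ hξ hε

/-- Along solutions the elastic state `y - c` stays admissible. -/
lemma IsSolution.add_mem_C {y : ℝ → Fin m → ℝ} (hy : S.IsSolution y) {x : ℝ → Fin m → ℝ}
    (hx : ∀ t, 0 ≤ t → x t = y t - S.c t) (hxc : Continuous (x - y)) {t : ℝ} (ht : 0 ≤ t) :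
    x t ∈ S.C := by
  have hycont : ContinuousOn y (Set.Ici 0) := by
    intro s hs
    have h1 := (hy.ac (s + 1) (by linarith [Set.mem_Ici.1 hs])).continuousOn
    have hs0 : (0 : ℝ) ≤ s := hs
    rw [Set.uIcc_of_le (by linarith)] at h1
    refine (h1 s ⟨hs, by linarith⟩).mono_of_mem_nhdsWithin ?_
    rw [← Set.Ici_inter_Iic]
    exact Filter.inter_mem self_mem_nhdsWithin
      (mem_nhdsWithin_of_mem_nhds (Iic_mem_nhds (by linarith)))
  have hxcont : ContinuousOn x (Set.Ici 0) := by
    have := hycont.add hxc.continuousOn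
    rwa [add_sub_cancel] at this
  have hmoving : ∀ s, 0 ≤ s → y s ∈ S.moving S.C s → x s ∈ S.C := by
    rintro s hs ⟨z, hz, hzy⟩
    rw [hx s hs, ← hzy]
    simpa using hz
  have hne : S.C.Nonempty := ⟨_, hmoving 0 le_rfl hy.init⟩
  -- The inclusion holds only almost everywhere; continuity of the distance to the closed set C
  -- extends membership to all times.
  have hae : (fun s => Metric.infDist (x s) S.C) =ᵐ[volume.restrict (Set.Ici 0)] fun _ => 0 := by
    filter_upwards [hy.incl, ae_restrict_mem measurableSet_Ici] with s hs hs0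
    exact Metric.infDist_zero_of_mem (hmoving s hs0 hs.2.1)
  have := Measure.eqOn_of_ae_eq hae
    ((Metric.continuous_infDist_pt S.C).comp_continuousOn hxcont) continuousOn_const
    (by rw [interior_Ici, closure_Ioi]) ht
  exact (S.isClosed_C.mem_iff_infDist_zero hne).2 this

/-- Velocity of the elastic state: `u - x'` belongs to the normal cone of `C` and is orthogonal to
the velocity `x'`. -/
lemma IsSolution.ae_hasDerivAt {y : ℝ → Fin m → ℝ} (hy : S.IsSolution y) {x : ℝ → Fin m → ℝ}
    (hx : ∀ t, 0 ≤ t → x t = y t - S.c t) {u : Fin m → ℝ}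
    (hxy : ∀ t, HasDerivAt (x - y) u t) :
    ∀ᵐ t ∂(volume.restrict (Set.Ici (0 : ℝ))), ∃ v, HasDerivAt x v t ∧
      (∀ ζ ∈ S.C, N.ip (u - v) (ζ - x t) ≤ 0) ∧ N.ip u v = N.ip v v := by
  have hxc : Continuous (x - y) :=
    continuous_iff_continuousAt.2 fun t => (hxy t).continuousAt
  filter_upwards [hy.incl, ae_pos_of_nonneg] with t ⟨hdiff, hn⟩ ht
  have hdx : HasDerivAt x (deriv y t + u) t := by
    have := hdiff.hasDerivAt.add (hxy t)
    rwa [add_sub_cancel] at this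
  have hcone : ∀ ζ ∈ S.C, N.ip (-deriv y t) (ζ - x t) ≤ 0 := fun ζ hζ => by
    have := hn.2.2 (ζ + S.c t) ⟨ζ, hζ, rfl⟩
    rw [hx t ht.le]
    convert this using 2
    abel
  have huv : u - (deriv y t + u) = -deriv y t := by abel
  refine ⟨deriv y t + u, hdx, by rwa [huv], ?_⟩
  -- Since x stays in C before and after t, the normal -y' is maximized along the trajectory at t;
  -- Fermat's theorem makes it orthogonal to x'.
  have hmax : IsLocalMax (fun s => N.ip (-deriv y t) (x s)) t := by
    filter_upwards [Ioi_mem_nhds ht] with s hs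
    have := hcone _ (hy.add_mem_C hx hxc (le_of_lt hs))
    rw [N.ip_sub_right] at this
    linarith
  have hd : HasDerivAt (fun s => N.ip (-deriv y t) (x s)) (N.ip (-deriv y t) (deriv y t + u)) t :=
    ((N.ipRight (-deriv y t)).toContinuousLinearMap.hasFDerivAt.comp_hasDerivAt t hdx :)
  have h0 := hmax.hasDerivAt_eq_zero hd
  rw [← huv, N.ip_sub_left] at h0
  linarith

/-- Finite-time convergence to the facet. -/
lemma exists_time_mem_facet {l₁ : ℝ} (hl : ∀ t, 0 ≤ t → HasDerivWithinAt N.l l₁ (Set.Ici 0) t)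
    {F : Set (Fin m → ℝ)} (hFne : F.Nonempty) (hFC : F ⊆ S.C) {u : Fin m → ℝ}
    (hu : u = l₁ • (S.Vbasis *ᵥ S.Lbar)) {Q : ℝ} (hQ : 0 < Q)
    (hgap : ∀ x ∈ S.C, ∃ z ∈ F, (∀ y ∈ F, N.ip u (y - x) = N.ip u (z - x)) ∧
      0 ≤ N.ip u (z - x) ∧ N.ip (x - z) (x - z) ≤ Q * N.ip u (z - x) ^ 2) :
    ∃ T > 0, ∀ y, S.IsSolution y → ∀ τ, T ≤ τ → y τ ∈ S.moving F τ := by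
  obtain ⟨y₀, hy₀⟩ := hFne
  obtain ⟨b, hb⟩ := S.exists_ip_bound u
  -- The initial value of φ is below the second factor for every solution, and φ falls at rate at
  -- least 1/Q.
  refine ⟨Q * (|N.ip u y₀ + b| + 1), by positivity, fun y hy τ hτ => ?_⟩
  have hτ0 : 0 ≤ τ := le_trans (by positivity) hτ
  -- The affine formula replaces `-c`, with which it agrees for t ≥ 0, because l is not controlled
  -- at negative times.
  let x : ℝ → Fin m → ℝ := y + fun t => N.l 0 • (S.Vbasis *ᵥ S.Lbar) + t • u
  have hx : ∀ t, 0 ≤ t → x t = y t - S.c t := fun t ht => by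
    simp only [x, Pi.add_apply, c, eq_affine_of_hasDerivWithinAt hl ht, hu, sub_neg_eq_add,
      add_smul, smul_smul, mul_comm t l₁]
  have hxy : ∀ t, HasDerivAt (x - y) u t := fun t => by
    have : x - y = fun t => N.l 0 • (S.Vbasis *ᵥ S.Lbar) + t • u := by simp [x]
    rw [this]
    simpa using ((hasDerivAt_id t).smul_const u).const_add (N.l 0 • (S.Vbasis *ᵥ S.Lbar))
  have hxC : ∀ t, 0 ≤ t → x t ∈ S.C := fun t ht =>
    hy.add_mem_C hx (continuous_iff_continuousAt.2 fun t => (hxy t).continuousAt) ht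
  let φ : ℝ → ℝ := fun t => N.ip u (y₀ - x t)
  have hφac : AbsolutelyContinuousOnInterval φ 0 τ := by
    have h1 := (hy.ac τ hτ0).clm_comp (N.ipRight u).toContinuousLinearMap
    have h2 : AbsolutelyContinuousOnInterval
        (fun t => (N.ip u y₀ - N.l 0 * N.ip u (S.Vbasis *ᵥ S.Lbar)) - t * N.ip u u) 0 τ := by
      refine ContDiffOn.absolutelyContinuousOnInterval (ContDiff.contDiffOn ?_)
      fun_prop
    have h3 : φ = (fun t => (N.ip u y₀ - N.l 0 * N.ip u (S.Vbasis *ᵥ S.Lbar)) - t * N.ip u u) -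
        fun t => (N.ipRight u).toContinuousLinearMap (y t) := by
      ext t
      change N.ip u (y₀ - (y t + (N.l 0 • (S.Vbasis *ᵥ S.Lbar) + t • u))) =
        N.ip u y₀ - N.l 0 * N.ip u (S.Vbasis *ᵥ S.Lbar) - t * N.ip u u - N.ip u (y t)
      rw [N.ip_sub_right, N.ip_add_right, N.ip_add_right, N.ip_smul_right, N.ip_smul_right]
      ring
    rw [h3]
    exact h2.sub h1
  have hderiv : ∀ {t : ℝ} {v : Fin m → ℝ}, HasDerivAt x v t → deriv φ t = -N.ip u v := by
    intro t v hv
    have h1 : HasDerivAt φ (N.ip u (-v)) t :=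
      ((N.ipRight u).toContinuousLinearMap.hasFDerivAt.comp_hasDerivAt t (hv.const_sub y₀) :)
    rw [h1.deriv]
    exact (N.ipRight u).map_neg v
  have hae := hy.ae_hasDerivAt hx hxy
  have hφτ : φ τ = 0 := by
    obtain ⟨z, hz, heq, hnn, -⟩ := hgap _ (hxC τ hτ0)
    refine eq_zero_of_deriv_le (δ := Q⁻¹) ?_ hτ0 hφac ?_ ?_ ?_
    · rw [inv_mul_eq_div, lt_div_iff₀ hQ]
      have h0 := hb _ (hxC 0 le_rfl)
      have h1 : φ 0 < |N.ip u y₀ + b| + 1 := by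
        simp only [φ, N.ip_sub_right]
        linarith [le_abs_self (N.ip u y₀ + b)]
      nlinarith
    · change 0 ≤ N.ip u (y₀ - x τ)
      rw [heq y₀ hy₀]
      exact hnn
    · filter_upwards [hae] with t ⟨v, hv, _, huv⟩
      rw [hderiv hv, huv]
      linarith [N.ip_self_nonneg v]
    · filter_upwards [hae, ae_restrict_mem measurableSet_Ici] with t ⟨v, hv, hcone, huv⟩ ht hpos
      obtain ⟨z, hz, heq, hnn, hle⟩ := hgap _ (hxC t ht)
      have hφ : φ t = N.ip u (z - x t) := heq y₀ hy₀
      rw [hderiv hv, huv, neg_le_neg_iff]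
      rw [← hφ] at hle
      have h1 : φ t ≤ N.ip v (z - x t) := by
        have := hcone z (hFC hz)
        rw [N.ip_sub_left] at this
        linarith
      have h2 : φ t ^ 2 ≤ N.ip v v * (Q * φ t ^ 2) := by
        calc φ t ^ 2 ≤ N.ip v (z - x t) ^ 2 := pow_le_pow_left₀ hpos.le h1 2
          _ ≤ N.ip v v * N.ip (z - x t) (z - x t) := N.ip_sq_le _ _
          _ = N.ip v v * N.ip (x t - z) (x t - z) := by
            simp only [N.ip_sub_left, N.ip_sub_right]
            ring
          _ ≤ _ := mul_le_mul_of_nonneg_left hle (N.ip_self_nonneg v)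
      -- Dividing the previous bound by φ² > 0 gives ‖x'‖² ≥ 1/Q.
      rw [inv_le_iff_one_le_mul₀ hQ]
      have h3 : 0 < φ t ^ 2 := by positivity
      by_contra hlt
      nlinarith [not_le.1 hlt]
  obtain ⟨z, hz, heq, -, hle⟩ := hgap _ (hxC τ hτ0)
  rw [← heq y₀ hy₀] at hle
  change _ ≤ Q * φ τ ^ 2 at hle
  rw [hφτ] at hle
  have h0 : x τ - z = 0 :=
    N.eq_zero_of_ip_self (le_antisymm (by simpa using hle) (N.ip_self_nonneg _))
  refine ⟨x τ, by rwa [sub_eq_zero.1 h0], ?_⟩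
  change x τ + S.c τ = y τ
  rw [hx τ hτ0, sub_add_cancel]

lemma eq_mulVec_of_mem_moving {s : ℝ → Fin m → ℝ} {F : Set (Fin m → ℝ)} {τ : ℝ}
    (h : N.A⁻¹ *ᵥ s τ - N.l τ • (S.Vbasis *ᵥ S.Lbar) ∈ S.moving F τ) : ∃ x ∈ F, s τ = N.A *ᵥ x := by
  obtain ⟨x, hx, hxs⟩ := h
  refine ⟨x, hx, ?_⟩
  have h1 : x = N.A⁻¹ *ᵥ s τ := by
    have h2 : x + -(N.l τ • (S.Vbasis *ᵥ S.Lbar)) =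
      N.A⁻¹ *ᵥ s τ - N.l τ • (S.Vbasis *ᵥ S.Lbar) := hxs
    rwa [← sub_eq_add_neg, sub_left_inj] at h2
  have hA : IsUnit N.A.det := by
    rw [SpringNetwork.A, Matrix.det_diagonal]
    exact (prod_ne_zero_iff.2 fun j _ => (N.a_pos j).ne').isUnit
  rw [h1, Matrix.mulVec_mulVec, Matrix.mul_nonsing_inv _ hA, Matrix.one_mulVec]

end MoreauMatrices

end Elastoplastic

theorem proposition2 {m n : ℕ} (N : Elastoplastic.SpringNetwork m n)
    (S : Elastoplastic.MoreauMatrices N)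
    (l₁ : ℝ) (hl : ∀ t, 0 ≤ t → HasDerivWithinAt N.l l₁ (Set.Ici 0) t)
    (I₀ I₁ : Finset (Elastoplastic.SignedIndex m))
    (hstrict : S.StrictConeInclusion l₁ I₀)
    (hcard : I₀.card + I₁.card = Elastoplastic.dimV m n)
    (hirr : I₀.card = Elastoplastic.dimV m n → S.Irreducible l₁ I₀)
    (hrank : I₀.card < Elastoplastic.dimV m n →
      (S.signedColMatrix (I₀ ∪ I₁)).rank = Elastoplastic.dimV m n)
    (hfeas : S.Feasible I₀ I₁)
    (hdiff : N.NonCoincident I₁) :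
    (∀ I ∈ Elastoplastic.flips I₁, S.hyperplanes (I₀ ∪ I) = {S.vertex (I₀ ∪ I)}) ∧
    (∃ ε > 0, ∀ τ, S.FacetCondition (S.F I₀ I₁) ε τ) ∧
    (∃ T > 0, ∀ y, S.IsSolution y → ∀ τ, T ≤ τ → y τ ∈ S.moving (S.F I₀ I₁) τ) ∧
    (∃ T > 0, ∀ s, S.IsStress s → ∀ τ, T ≤ τ →
      s τ ∈ convexHull ℝ
        {x | ∃ I ∈ Elastoplastic.flips I₁, x = N.A *ᵥ S.vertex (I₀ ∪ I)}) := by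
  obtain ⟨hspan, hK⟩ :=
    Elastoplastic.MoreauMatrices.span_signedCol_union hstrict.1 hcard hirr hrank
  obtain ⟨B, hBV, hBc, hBu⟩ :=
    Elastoplastic.MoreauMatrices.exists_parametrization hspan hK
  have hB : S.IsParametrization (I₀ ∪ I₁) B := ⟨hBV, hBc, hBu⟩
  have hdisj : Disjoint I₀ I₁ := Finset.card_union_eq_card_add_card.1 (hK.trans hcard.symm)
  obtain ⟨w, hw, hsum⟩ := hstrict.exists_pos
  -- The cone relation in ℝ^d is carried to V by the linear map `lift`.
  have hu : l₁ • (S.Vbasis *ᵥ S.Lbar) = ∑ p ∈ I₀, w p • S.normal p := by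
    rw [← S.lift_firstVec, ← map_smul, ← hsum, map_sum]
    exact Finset.sum_congr rfl fun p _ => map_smul _ _ _
  have hFC := hB.F_subset_C hdisj hfeas
  obtain ⟨ε, hε, hcone⟩ := hB.exists_add_mem_normalCone hdisj hFC hw hu
  obtain ⟨Q, hQ, hgap⟩ := hB.exists_gap_bound hdisj hw hu
  obtain ⟨T, hT, hconv⟩ :=
    Elastoplastic.MoreauMatrices.exists_time_mem_facet hl hB.F_nonempty hFC rfl hQ hgap
  refine ⟨fun I hI => hB.hyperplanes_eq_vertex hdisj hI,
    ⟨ε, hε, Elastoplastic.MoreauMatrices.facetCondition_of_forall hl hcone⟩,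
    ⟨T, hT, hconv⟩, T, hT, fun s hs τ hτ => ?_⟩
  obtain ⟨x, hx, hsx⟩ :=
    Elastoplastic.MoreauMatrices.eq_mulVec_of_mem_moving (hconv _ hs τ hτ)
  rw [hsx]
  have himg : N.A.mulVecLin x ∈ N.A.mulVecLin ''
      convexHull ℝ {x | ∃ I ∈ Elastoplastic.flips I₁, x = S.vertex (I₀ ∪ I)} :=
    Set.mem_image_of_mem _ (hB.F_subset_convexHull hdisj hx)
  rw [LinearMap.image_convexHull] at himg
  refine convexHull_mono ?_ himg
  rintro _ ⟨_, ⟨I, hI, rfl⟩, rfl⟩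
  exact ⟨I, hI, rfl⟩
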